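/- Let $n\ge 1$, let $\mathcal H_1,\dots,\mathcal H_n$ be complex Hilbert spaces with $\dim\mathcal H_i=d_i$, $2\le d_i<\infty$, and let $|\psi\rangle=\sum_{s_1,\dots,s_n}\alpha_{s_1\cdots s_n}|s_1\cdots s_n\rangle\in\bigotimes_{i=1}^n\mathcal H_i$ be a unit vector (an $n$-qudit pure state), where $\sum_{s_1,\dots,s_n}|\alpha_{s_1\cdots s_n}|^2=1$. For a pure state $|\varphi\rangle\in\mathcal H_A\otimes\mathcal H_B$ and real $q,s$ with $q\ge 1$ and $qs\ge 1$, the unified $(q,s)$-concurrence is $$C_{q,s}(|\varphi\rangle)=1-\bigl(\operatorname{tr}\rho_A^{\,q}\bigr)^s,\qquad \rho_A=\operatorname{tr}_B|\varphi\rangle\langle\varphi| .$$ For $j\in\{1,\dots,n\}$ let $C_{q,s}^{j|\overline j}(|\psi\rangle)$ denote the unified $(q,s)$-concurrence of $|\psi\rangle$ with respect to the bipartition $\mathcal H_A=\mathcal H_j$, $\mathcal H_B=\bigotimes_{k\ne j}\mathcal H_k$. Then for all real $q,s$ with $q\ge 1$ and $qs\ge 1$ and every $j\in\{1,\dots,n\}$,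 $$C_{q,s}^{j|\overline j}(|\psi\rangle)\le\sum_{k\ne j}C_{q,s}^{k|\overline k}(|\psi\rangle).$$ -/

import Mathlib

noncomputable section

namespace UnifiedConcurrence

open scoped Matrix

/-- The density operator `|ψ⟩⟨ψ|` of a vector `ψ`, as a matrix in the computational basis. -/
def pureDensity {a : Type*} (ψ : EuclideanSpace ℂ a) : Matrix a a ℂ :=
  Matrix.vecMulVec (fun x => ψ x) (fun x => star (ψ x))

/-- The partial trace `tr_B` over the second tensor factor. -/
def partialTraceRight {a b : Type*} [Fintype b] (M : Matrix (a × b) (a × b) ℂ) :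
    Matrix a a ℂ :=
  Matrix.of fun x x' => ∑ y, M (x, y) (x', y)

/-- The reduced density operator `ρ_A = tr_B |ψ⟩⟨ψ|` of a vector of `H_A ⊗ H_B`. -/
def reducedDensity {a b : Type*} [Fintype b] (ψ : EuclideanSpace ℂ (a × b)) : Matrix a a ℂ :=
  partialTraceRight (pureDensity ψ)

/-- `tr ρ^q` for a positive semidefinite matrix `ρ` and a real exponent `q`; the power `ρ^q` is
given by the functional calculus. -/
def tracePow {a : Type*} [Fintype a] [DecidableEq a] (ρ : Matrix a a ℂ) (q : ℝ) : ℝ :=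
  (Matrix.trace (cfc (fun x : ℝ => x ^ q) ρ)).re

open Classical in
/-- The sign factor `ε_{q,s}`. It is defined only in the two listed ranges of parameters; the value
`0` elsewhere is a placeholder. -/
def signFactor (q s : ℝ) : ℝ :=
  if 1 ≤ q ∧ 1 ≤ q * s then 1
  else if (0 < q ∧ q < 1) ∧ (0 < q * s ∧ q * s < 1) then -1
  else 0

/-- The unified `(q,s)`-concurrence `C_{q,s}(ψ) = ε_{q,s} (1 - (tr ρ_A^q)^s)` of a bipartite pure
state `ψ` of `H_A ⊗ H_B`. -/
def concurrence {a b : Type*} [Fintype a] [DecidableEq a] [Fintype b] (q s : ℝ)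
    (ψ : EuclideanSpace ℂ (a × b)) : ℝ :=
  signFactor q s * (1 - (tracePow (reducedDensity ψ) q) ^ s)

/-- The space `H_1 ⊗ ⋯ ⊗ H_n` with `dim H_i = d i`: a vector is given by its coefficients
`α_{s_1 ⋯ s_n}` in the computational basis. -/
abbrev QuditSpace {n : ℕ} (d : Fin n → ℕ) : Type :=
  EuclideanSpace ℂ ((i : Fin n) → Fin (d i))

/-- A multipartite vector regarded as a bipartite vector of `H_j ⊗ (⨂_{k ≠ j} H_k)`. -/
def splitAt {n : ℕ} {d : Fin n → ℕ} (j : Fin n) (ψ : QuditSpace d) :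
    EuclideanSpace ℂ (Fin (d j) × ((k : {k : Fin n // k ≠ j}) → Fin (d k))) :=
  WithLp.toLp 2 fun p => ψ ((Equiv.piSplitAt j fun i => Fin (d i)).symm p)

/-- The one-to-group marginal entanglement `C_{q,s}^{j | j̄}(ψ)`. -/
def marginalConcurrence {n : ℕ} {d : Fin n → ℕ} (q s : ℝ) (j : Fin n) (ψ : QuditSpace d) : ℝ :=
  concurrence q s (splitAt j ψ)

end UnifiedConcurrence

end

namespace UnifiedConcurrence

open scoped Matrix

theorem rpow_add_rpow_le_one_add_rpow {t a b c : ℝ} (ht : 1 ≤ t) (hc : 0 ≤ c) (hca : c < a)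
    (ha : a ≤ 1) (h : a + b = 1 + c) : a ^ t + b ^ t ≤ 1 + c ^ t := by
  have h1c : 0 < 1 - c := by linarith
  have hθ₀ : 0 ≤ (a - c) / (1 - c) := by apply div_nonneg <;> linarith
  have hθ₁ : 0 ≤ (1 - a) / (1 - c) := by apply div_nonneg <;> linarith
  have hθ : (a - c) / (1 - c) + (1 - a) / (1 - c) = 1 := by field_simp; ring
  have h1 := (convexOn_rpow ht).2 (x := 1) (y := c) (by simp) hc hθ₀ hθ₁ hθ
  have h2 := (convexOn_rpow ht).2 (x := c) (y := 1) hc (by simp) hθ₀ hθ₁ hθ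
  have e1 : (a - c) / (1 - c) * 1 + (1 - a) / (1 - c) * c = a := by field_simp; ring
  have e2 : (a - c) / (1 - c) * c + (1 - a) / (1 - c) * 1 = b := by
    obtain rfl : b = 1 + c - a := by linarith
    field_simp; ring
  simp only [smul_eq_mul, e1, e2, Real.one_rpow] at h1 h2
  have : (a - c) / (1 - c) * c ^ t + (1 - a) / (1 - c) * c ^ t = c ^ t := by
    rw [← add_mul, hθ, one_mul]
  linarith

/-- The map `x ↦ 1 - (1 - x) ^ t` is subadditive on the unit interval. -/
theorem one_sub_rpow_le_sum {ι : Type*} (s : Finset ι) {t : ℝ} (ht : 1 ≤ t) {a : ι → ℝ}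
    (ha₀ : ∀ i ∈ s, 0 ≤ a i) (ha₁ : ∀ i ∈ s, a i ≤ 1) {c : ℝ} (hc₀ : 0 ≤ c) (hc₁ : c ≤ 1)
    (h : 1 - c ≤ ∑ i ∈ s, (1 - a i)) : 1 - c ^ t ≤ ∑ i ∈ s, (1 - a i ^ t) := by
  classical
  induction s using Finset.induction_on generalizing c with
  | empty =>
    obtain rfl : c = 1 := by simp at h; linarith
    simp
  | insert i s hi ih =>
    rw [Finset.sum_insert hi] at h ⊢
    simp only [Finset.mem_insert, forall_eq_or_imp] at ha₀ ha₁
    rcases le_or_gt (a i) c with hac | hac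
    · have h1 : a i ^ t ≤ c ^ t := Real.rpow_le_rpow ha₀.1 hac (by linarith)
      have h2 : 0 ≤ ∑ i ∈ s, (1 - a i ^ t) := Finset.sum_nonneg fun k hk => by
        have := Real.rpow_le_one (ha₀.2 k hk) (ha₁.2 k hk) (by linarith : 0 ≤ t)
        linarith
      linarith
    · have h1 := ih ha₀.2 ha₁.2 (c := 1 + c - a i) (by linarith) (by linarith) (by linarith)
      have h2 := rpow_add_rpow_le_one_add_rpow (b := 1 + c - a i) ht hc₀ hac ha₁.1 (by ring)
      linarith

theorem one_sub_prod_le_sum {ι : Type*} (s : Finset ι) {x : ι → ℝ}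
    (h₀ : ∀ i ∈ s, 0 ≤ x i) (h₁ : ∀ i ∈ s, x i ≤ 1) :
    1 - ∏ i ∈ s, x i ≤ ∑ i ∈ s, (1 - x i) := by
  classical
  induction s using Finset.induction_on with
  | empty => simp
  | insert i s hi ih =>
    rw [Finset.sum_insert hi, Finset.prod_insert hi]
    simp only [Finset.mem_insert, forall_eq_or_imp] at h₀ h₁
    have h1 := ih h₀.2 h₁.2
    have h2 := Finset.prod_le_one h₀.2 h₁.2
    nlinarith [h₀.1, h₁.1]

/-- The `ℓ^q` norm of a family of reals. -/
noncomputable def lpNorm {a : Type*} [Fintype a] (q : ℝ) (f : a → ℝ) : ℝ :=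
  (∑ x, f x ^ q) ^ (1 / q)

theorem exists_dual_lpNorm {a : Type*} [Fintype a] {p q : ℝ} (hpq : p.HolderConjugate q)
    {f : a → ℝ} (hf : ∀ x, 0 ≤ f x) (hsum : ∑ x, f x = 1) :
    ∃ X : a → ℝ, (∀ x, 0 ≤ X x) ∧ (∀ x, X x ≤ 1) ∧ ∑ x, f x * X x = lpNorm p f ∧
      ∑ x, X x ^ q = 1 := by
  have hp : 0 < p := hpq.pos
  have hS : 0 < ∑ x, f x ^ p := by
    obtain ⟨x, -, hx⟩ := Finset.exists_ne_zero_of_sum_ne_zero (hsum.trans_ne one_ne_zero)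
    exact Finset.sum_pos' (fun y _ => Real.rpow_nonneg (hf y) p)
      ⟨x, Finset.mem_univ x, Real.rpow_pos_of_pos ((hf x).lt_of_ne' hx) p⟩
  set N := lpNorm p f with hN
  have hN0 : 0 < N := Real.rpow_pos_of_pos hS _
  have hNp : N ^ p = ∑ x, f x ^ p := by
    rw [hN, lpNorm, one_div, Real.rpow_inv_rpow hS.le hp.ne']
  have hX0 : ∀ x, 0 ≤ (f x / N) ^ (p - 1) := fun x =>
    Real.rpow_nonneg (div_nonneg (hf x) hN0.le) _
  have hXq : ∑ x, ((f x / N) ^ (p - 1)) ^ q = 1 := by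
    have : ∀ x, ((f x / N) ^ (p - 1)) ^ q = f x ^ p / N ^ p := fun x => by
      rw [← Real.rpow_mul (div_nonneg (hf x) hN0.le), hpq.sub_one_mul_conj,
        Real.div_rpow (hf x) hN0.le]
    rw [Finset.sum_congr rfl fun x _ => this x, ← Finset.sum_div, hNp, div_self hS.ne']
  refine ⟨fun x => (f x / N) ^ (p - 1), hX0, fun x => ?_, ?_, hXq⟩
  · have h1 : ((f x / N) ^ (p - 1)) ^ q ≤ 1 := by
      refine le_trans ?_ hXq.le
      exact Finset.single_le_sum (f := fun x => ((f x / N) ^ (p - 1)) ^ q)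
        (fun y _ => Real.rpow_nonneg (hX0 y) q) (Finset.mem_univ x)
    by_contra! h
    exact absurd h1 (not_le.2 (Real.one_lt_rpow h hpq.symm.pos))
  · have : ∀ x, f x * (f x / N) ^ (p - 1) = N * (f x ^ p / N ^ p) := fun x => by
      rcases (hf x).eq_or_lt with h | h
      · simp [← h, Real.zero_rpow hp.ne']
      · rw [← Real.div_rpow (hf x) hN0.le, Real.rpow_sub_one (div_pos h hN0).ne']
        field_simp
    rw [Finset.sum_congr rfl fun x _ => this x, ← Finset.mul_sum, ← Finset.sum_div, hNp,
      div_self hS.ne', mul_one]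

/-- Bessel's inequality for a matrix with orthogonal rows. -/
theorem sum_norm_sq_div_le_one {a b : Type*} [Fintype a] [DecidableEq a] [Fintype b]
    {A : Matrix a b ℂ} {l : a → ℝ}
    (hA : A * Aᴴ = Matrix.diagonal fun x => (l x : ℂ)) (y : b) :
    ∑ x, ‖A x y‖ ^ 2 / l x ≤ 1 := by
  set D : Matrix a a ℂ := Matrix.diagonal fun x => ((l x)⁻¹ : ℂ) with hD
  have hrow : ∀ x, l x = 0 → ∀ z, A x z = 0 := fun x hx z => by
    have h := congrFun (congrFun hA x) x
    have h2 : ∑ z, ‖A x z‖ ^ 2 = 0 := by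
      simp only [Matrix.mul_apply, Matrix.conjTranspose_apply, Matrix.diagonal_apply_eq, hx,
        Complex.ofReal_zero, Complex.star_def, Complex.mul_conj, Complex.normSq_eq_norm_sq] at h
      exact_mod_cast h
    rw [Finset.sum_eq_zero_iff_of_nonneg fun _ _ => by positivity] at h2
    simpa using h2 z (Finset.mem_univ z)
  set P : Matrix b b ℂ := Aᴴ * D * A with hP
  have hPP : P * P = P := by
    have h1 : D * (Matrix.diagonal fun x => (l x : ℂ)) * (D * A) = D * A := by
      rw [hD, Matrix.diagonal_mul_diagonal]
      ext x z
      rw [Matrix.diagonal_mul, Matrix.diagonal_mul]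
      by_cases hx : l x = 0
      · simp [hrow x hx]
      · rw [inv_mul_cancel₀ (by exact_mod_cast hx), one_mul]
    calc P * P = Aᴴ * (D * (A * Aᴴ) * (D * A)) := by simp only [hP, Matrix.mul_assoc]
      _ = P := by rw [hA, h1, hP, Matrix.mul_assoc]
  have hPH : Pᴴ = P := by
    have : Dᴴ = D := by
      rw [hD, Matrix.diagonal_conjTranspose]; congr 1; ext x; simp
    simp only [hP, Matrix.conjTranspose_mul, Matrix.conjTranspose_conjTranspose, this,
      Matrix.mul_assoc]
  have hPy : P y y = ((∑ x, ‖A x y‖ ^ 2 / l x : ℝ) : ℂ) := by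
    rw [hP, Matrix.mul_apply, Complex.ofReal_sum]
    refine Finset.sum_congr rfl fun x _ => ?_
    rw [hD, Matrix.mul_diagonal, Matrix.conjTranspose_apply, mul_right_comm, Complex.star_def,
      mul_comm ((starRingEnd ℂ) _), Complex.mul_conj, Complex.normSq_eq_norm_sq]
    push_cast
    ring
  have hPsum : P y y = ((∑ z, ‖P y z‖ ^ 2 : ℝ) : ℂ) := by
    conv_lhs => rw [← hPP, Matrix.mul_apply]
    rw [Complex.ofReal_sum]
    refine Finset.sum_congr rfl fun z _ => ?_
    have : P z y = star (P y z) := by rw [← Matrix.conjTranspose_apply, hPH]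
    rw [this, Complex.star_def, Complex.mul_conj, Complex.normSq_eq_norm_sq]
  have hle : ‖P y y‖ ^ 2 ≤ ∑ z, ‖P y z‖ ^ 2 :=
    Finset.single_le_sum (f := fun z => ‖P y z‖ ^ 2) (fun _ _ => by positivity)
      (Finset.mem_univ y)
  have heq : ∑ x, ‖A x y‖ ^ 2 / l x = ∑ z, ‖P y z‖ ^ 2 := by
    exact_mod_cast hPy.symm.trans hPsum
  rw [← heq, hPy, Complex.norm_real, Real.norm_eq_abs, sq_abs] at hle
  nlinarith

/-- The diagonal of `Aᴴ * A` has smaller `ℓ^q` norm than the nonzero spectrum of `A * Aᴴ`. -/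
theorem sum_colNorm_rpow_le {a b : Type*} [Fintype a] [DecidableEq a] [Fintype b]
    {A : Matrix a b ℂ} {l : a → ℝ} (hl : ∀ x, 0 ≤ l x)
    (hA : A * Aᴴ = Matrix.diagonal fun x => (l x : ℂ)) {q : ℝ} (hq : 1 ≤ q) :
    ∑ y, (∑ x, ‖A x y‖ ^ 2) ^ q ≤ ∑ x, l x ^ q := by
  have hq0 : 0 < q := by linarith
  have hrow : ∀ x, ∑ y, ‖A x y‖ ^ 2 = l x := fun x => by
    have h := congrFun (congrFun hA x) x
    simp only [Matrix.mul_apply, Matrix.conjTranspose_apply, Matrix.diagonal_apply_eq,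
      Complex.star_def, Complex.mul_conj, Complex.normSq_eq_norm_sq] at h
    exact_mod_cast h
  have hzero : ∀ x y, l x = 0 → ‖A x y‖ ^ 2 = 0 := fun x y hx => by
    have h := hrow x
    rw [hx, Finset.sum_eq_zero_iff_of_nonneg fun _ _ => by positivity] at h
    exact h y (Finset.mem_univ y)
  have hw0 : ∀ x y, 0 ≤ ‖A x y‖ ^ 2 / l x := fun x y => div_nonneg (by positivity) (hl x)
  have hcol : ∀ y, (∑ x, ‖A x y‖ ^ 2) ^ q ≤ ∑ x, ‖A x y‖ ^ 2 / l x * l x ^ q := fun y => by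
    have h1 := Real.inner_le_weight_mul_Lp_of_nonneg Finset.univ hq
      (fun x => ‖A x y‖ ^ 2 / l x) l (fun x => hw0 x y) hl
    have hT : 0 ≤ ∑ x, ‖A x y‖ ^ 2 / l x * l x ^ q := Finset.sum_nonneg fun x _ =>
      mul_nonneg (hw0 x y) (Real.rpow_nonneg (hl x) q)
    have h2 : ∑ x, ‖A x y‖ ^ 2 ≤ (∑ x, ‖A x y‖ ^ 2 / l x * l x ^ q) ^ q⁻¹ := by
      calc ∑ x, ‖A x y‖ ^ 2 = ∑ x, ‖A x y‖ ^ 2 / l x * l x :=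
            Finset.sum_congr rfl fun x _ => by
              by_cases hx : l x = 0
              · rw [hzero x y hx]; simp
              · field_simp
        _ ≤ _ := h1
        _ ≤ 1 * (∑ x, ‖A x y‖ ^ 2 / l x * l x ^ q) ^ q⁻¹ := by
            refine mul_le_mul_of_nonneg_right ?_ (Real.rpow_nonneg hT _)
            exact Real.rpow_le_one (Finset.sum_nonneg fun x _ => hw0 x y)
              (sum_norm_sq_div_le_one hA y) (sub_nonneg.2 (inv_le_one_of_one_le₀ hq))
        _ = _ := one_mul _
    calc _ ≤ ((∑ x, ‖A x y‖ ^ 2 / l x * l x ^ q) ^ q⁻¹) ^ q :=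
          Real.rpow_le_rpow (Finset.sum_nonneg fun _ _ => by positivity) h2 hq0.le
      _ = _ := Real.rpow_inv_rpow hT hq0.ne'
  calc _ ≤ ∑ y, ∑ x, ‖A x y‖ ^ 2 / l x * l x ^ q := Finset.sum_le_sum fun y _ => hcol y
    _ = ∑ x, (∑ y, ‖A x y‖ ^ 2) / l x * l x ^ q := by
        rw [Finset.sum_comm]
        simp only [Finset.sum_div, Finset.sum_mul]
    _ = ∑ x, l x ^ q := Finset.sum_congr rfl fun x _ => by
        rw [hrow x]
        by_cases hx : l x = 0
        · simp [hx, Real.zero_rpow hq0.ne']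
        · rw [div_self hx, one_mul]

section ProductMatrix

variable {ι : Type*} [Fintype ι] {κ : ι → Type*}

/-- The Kronecker product of a finite family of matrices. -/
def productMatrix (M : ∀ i, Matrix (κ i) (κ i) ℂ) : Matrix (∀ i, κ i) (∀ i, κ i) ℂ :=
  Matrix.of fun r s => ∏ i, M i (r i) (s i)

theorem productMatrix_mul [DecidableEq ι] [∀ i, Fintype (κ i)]
    (M N : ∀ i, Matrix (κ i) (κ i) ℂ) :
    productMatrix M * productMatrix N = productMatrix fun i => M i * N i := by
  ext r s
  simp only [productMatrix, Matrix.mul_apply, Matrix.of_apply, Fintype.prod_sum,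
    Finset.prod_mul_distrib]

theorem productMatrix_one [∀ i, DecidableEq (κ i)] [DecidableEq (∀ i, κ i)] :
    productMatrix (fun i => (1 : Matrix (κ i) (κ i) ℂ)) = 1 := by
  ext r s
  simp only [productMatrix, Matrix.of_apply, Matrix.one_apply]
  by_cases h : r = s
  · simp [h]
  · obtain ⟨i, hi⟩ := Function.ne_iff.1 h
    rw [if_neg h]
    exact Finset.prod_eq_zero (Finset.mem_univ i) (if_neg hi)

theorem conjTranspose_productMatrix (M : ∀ i, Matrix (κ i) (κ i) ℂ) :
    (productMatrix M)ᴴ = productMatrix fun i => (M i)ᴴ := by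
  ext r s
  simp [productMatrix, Matrix.conjTranspose_apply, star_prod]

/-- The coefficients of a multipartite vector, as a matrix with rows indexed by the factor `k`. -/
def coeffMatrix [DecidableEq ι] (k : ι) (φ : (∀ i, κ i) → ℂ) :
    Matrix (κ k) (∀ i : {i // i ≠ k}, κ i) ℂ :=
  Matrix.of fun x y => φ ((Equiv.piSplitAt k κ).symm (x, y))

theorem piSplitAt_symm_self {ι : Type*} [DecidableEq ι] {κ : ι → Type*} (k : ι)
    (p : κ k × ∀ i : {i // i ≠ k}, κ i) : (Equiv.piSplitAt k κ).symm p k = p.1 :=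
  congrArg Prod.fst ((Equiv.piSplitAt k κ).apply_symm_apply p)

theorem piSplitAt_symm_ne {ι : Type*} [DecidableEq ι] {κ : ι → Type*} (k : ι)
    (p : κ k × ∀ i : {i // i ≠ k}, κ i) (i : {i // i ≠ k}) :
    (Equiv.piSplitAt k κ).symm p i = p.2 i :=
  congrFun (congrArg Prod.snd ((Equiv.piSplitAt k κ).apply_symm_apply p)) i

theorem coeffMatrix_mulVec [DecidableEq ι] [∀ i, Fintype (κ i)]
    (M : ∀ i, Matrix (κ i) (κ i) ℂ) (k : ι) (φ : (∀ i, κ i) → ℂ) :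
    coeffMatrix k (productMatrix M *ᵥ φ) =
      M k * coeffMatrix k φ * (productMatrix fun i : {i // i ≠ k} => M i)ᵀ := by
  ext x y
  simp only [coeffMatrix, Matrix.mul_apply, Matrix.of_apply, Matrix.transpose_apply,
    productMatrix, Matrix.mulVec, dotProduct, Finset.sum_mul]
  rw [← (Equiv.piSplitAt k κ).symm.sum_comp, Fintype.sum_prod_type, Finset.sum_comm]
  refine Finset.sum_congr rfl fun y' _ => Finset.sum_congr rfl fun x' _ => ?_
  rw [Fintype.prod_eq_mul_prod_subtype_ne _ k]
  simp only [piSplitAt_symm_self, piSplitAt_symm_ne]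
  ring

theorem coeffMatrix_mulVec_mul_conjTranspose [DecidableEq ι] [∀ i, Fintype (κ i)]
    [∀ i, DecidableEq (κ i)] {M : ∀ i, Matrix (κ i) (κ i) ℂ} (hM : ∀ i, (M i)ᴴ * M i = 1)
    (k : ι) (φ : (∀ i, κ i) → ℂ) :
    coeffMatrix k (productMatrix M *ᵥ φ) * (coeffMatrix k (productMatrix M *ᵥ φ))ᴴ =
      M k * (coeffMatrix k φ * (coeffMatrix k φ)ᴴ) * (M k)ᴴ := by
  classical
  set Q := productMatrix fun i : {i // i ≠ k} => M i with hQ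
  have hQQ : Qᵀ * (Qᵀ)ᴴ = 1 := by
    have hT : (Qᵀ)ᴴ = (Qᴴ)ᵀ := rfl
    rw [hT, ← Matrix.transpose_mul, hQ,
      conjTranspose_productMatrix, productMatrix_mul]
    simp only [hM, productMatrix_one, Matrix.transpose_one]
  rw [coeffMatrix_mulVec, ← hQ, Matrix.conjTranspose_mul, Matrix.conjTranspose_mul]
  calc _ = M k * coeffMatrix k φ * (Qᵀ * (Qᵀ)ᴴ) * ((coeffMatrix k φ)ᴴ * (M k)ᴴ) := by
        simp only [Matrix.mul_assoc]
    _ = _ := by rw [hQQ, Matrix.mul_one]; simp only [Matrix.mul_assoc]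

theorem trace_coeffMatrix_mul_conjTranspose [DecidableEq ι] [∀ i, Fintype (κ i)]
    (k : ι) (φ : (∀ i, κ i) → ℂ) :
    (coeffMatrix k φ * (coeffMatrix k φ)ᴴ).trace = ((∑ s, ‖φ s‖ ^ 2 : ℝ) : ℂ) := by
  rw [← (Equiv.piSplitAt k κ).symm.sum_comp, Fintype.sum_prod_type]
  simp only [Matrix.trace, Matrix.diag_apply, Matrix.mul_apply, Matrix.conjTranspose_apply,
    Complex.star_def, Complex.mul_conj, Complex.normSq_eq_norm_sq, Complex.ofReal_sum]
  rfl

/-- If all one-party marginals of `φ` are diagonal, then the `ℓ^q` norms of their spectra satisfy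
the one-to-group inequality. -/
theorem one_sub_lpNorm_le_sum [DecidableEq ι] [∀ i, Fintype (κ i)] [∀ i, DecidableEq (κ i)]
    {φ : (∀ i, κ i) → ℂ} (hφ : ∑ s, ‖φ s‖ ^ 2 = 1) {l : ∀ i, κ i → ℝ}
    (hl : ∀ i x, 0 ≤ l i x)
    (hA : ∀ i, coeffMatrix i φ * (coeffMatrix i φ)ᴴ = Matrix.diagonal fun x => (l i x : ℂ))
    {p : ℝ} (hp : 1 < p) (j : ι) :
    1 - lpNorm p (l j) ≤ ∑ k ∈ Finset.univ.erase j, (1 - lpNorm p (l k)) := by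
  have hpq := Real.HolderConjugate.conjExponent hp
  set q := p.conjExponent
  have hmarg : ∀ k x, l k x = ∑ y, ‖coeffMatrix k φ x y‖ ^ 2 := fun k x => by
    have h := congrFun (congrFun (hA k) x) x
    simp only [Matrix.mul_apply, Matrix.conjTranspose_apply, Matrix.diagonal_apply_eq,
      Complex.star_def, Complex.mul_conj, Complex.normSq_eq_norm_sq] at h
    exact_mod_cast h.symm
  have hexp : ∀ k (f : κ k → ℝ), ∑ x, l k x * f x = ∑ s, ‖φ s‖ ^ 2 * f (s k) := fun k f => by
    rw [← (Equiv.piSplitAt k κ).symm.sum_comp, Fintype.sum_prod_type]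
    refine Finset.sum_congr rfl fun x _ => ?_
    rw [hmarg, Finset.sum_mul]
    exact Finset.sum_congr rfl fun y _ => by rw [piSplitAt_symm_self]; rfl
  have hl1 : ∀ k, ∑ x, l k x = 1 := fun k => by
    have := hexp k fun _ => 1
    simpa [hφ] using this
  choose X hX0 hX1 hXl hXq using fun k => exists_dual_lpNorm hpq (hl k) (hl1 k)
  set Z : (∀ i : {i // i ≠ j}, κ i) → ℝ := fun y => ∏ i : {i // i ≠ j}, X i (y i) with hZ
  have hprod : ∀ s : ∀ i, κ i,
      ∏ k ∈ Finset.univ.erase j, X k (s k) = Z fun i => s i := fun s => by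
    exact Finset.prod_subtype _ (by simp) fun k => X k (s k)
  have hlow : 1 - ∑ s, ‖φ s‖ ^ 2 * Z (fun i => s i) ≤
      ∑ k ∈ Finset.univ.erase j, (1 - lpNorm p (l k)) := by
    calc 1 - ∑ s, ‖φ s‖ ^ 2 * Z (fun i => s i)
        = ∑ s, ‖φ s‖ ^ 2 * (1 - ∏ k ∈ Finset.univ.erase j, X k (s k)) := by
          simp only [hprod, mul_sub, mul_one, Finset.sum_sub_distrib, hφ]
      _ ≤ ∑ s, ‖φ s‖ ^ 2 * ∑ k ∈ Finset.univ.erase j, (1 - X k (s k)) := by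
          refine Finset.sum_le_sum fun s _ => mul_le_mul_of_nonneg_left ?_ (by positivity)
          exact one_sub_prod_le_sum _ (fun k _ => hX0 k _) fun k _ => hX1 k _
      _ = ∑ k ∈ Finset.univ.erase j, (1 - lpNorm p (l k)) := by
          simp only [Finset.mul_sum]
          rw [Finset.sum_comm]
          refine Finset.sum_congr rfl fun k _ => ?_
          simp only [mul_sub, mul_one, Finset.sum_sub_distrib, hφ]
          rw [← hexp k (X k), hXl]
  have hup : ∑ s, ‖φ s‖ ^ 2 * Z (fun i => s i) ≤ lpNorm p (l j) := by
    have hcol0 : ∀ y, 0 ≤ ∑ x, ‖coeffMatrix j φ x y‖ ^ 2 :=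
      fun y => Finset.sum_nonneg fun _ _ => by positivity
    have hZq : ∑ y, Z y ^ q = 1 := by
      have : ∀ y, Z y ^ q = ∏ i : {i // i ≠ j}, X i (y i) ^ q := fun y =>
        (Real.finsetProd_rpow _ (fun i : {i // i ≠ j} => X i (y i)) (fun i _ => hX0 i _) q).symm
      rw [Finset.sum_congr rfl fun y _ => this y,
        ← Fintype.prod_sum fun (i : {i // i ≠ j}) x => X i x ^ q]
      exact Finset.prod_eq_one fun i _ => hXq i
    calc ∑ s, ‖φ s‖ ^ 2 * Z (fun i => s i)
        = ∑ y, (∑ x, ‖coeffMatrix j φ x y‖ ^ 2) * Z y := by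
          rw [← (Equiv.piSplitAt j κ).symm.sum_comp, Fintype.sum_prod_type, Finset.sum_comm]
          refine Finset.sum_congr rfl fun y _ => ?_
          rw [Finset.sum_mul]
          refine Finset.sum_congr rfl fun x _ => ?_
          simp only [piSplitAt_symm_ne]
          rfl
      _ ≤ lpNorm p (fun y => ∑ x, ‖coeffMatrix j φ x y‖ ^ 2) * (∑ y, Z y ^ q) ^ (1 / q) :=
          Real.inner_le_Lp_mul_Lq_of_nonneg _ hpq (fun y _ => hcol0 y)
            fun y _ => Finset.prod_nonneg fun i _ => hX0 i _
      _ = lpNorm p (fun y => ∑ x, ‖coeffMatrix j φ x y‖ ^ 2) := by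
          rw [hZq, Real.one_rpow, mul_one]
      _ ≤ lpNorm p (l j) := by
          refine Real.rpow_le_rpow (Finset.sum_nonneg fun y _ => Real.rpow_nonneg (hcol0 y) p)
            (sum_colNorm_rpow_le (hl j) (hA j) hp.le) ?_
          exact one_div_nonneg.2 hpq.nonneg
  linarith

end ProductMatrix

theorem tracePow_eq_sum_eigenvalues {a : Type*} [Fintype a] [DecidableEq a]
    {ρ : Matrix a a ℂ} (hρ : ρ.IsHermitian) (q : ℝ) :
    tracePow ρ q = ∑ x, hρ.eigenvalues x ^ q := by
  rw [tracePow, hρ.cfc_eq, Matrix.IsHermitian.cfc, Unitary.conjStarAlgAut_apply,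
    Matrix.trace_mul_comm, ← Matrix.mul_assoc, Unitary.coe_star_mul_self, Matrix.one_mul,
    Matrix.trace_diagonal]
  simp [Function.comp_def]

theorem reducedDensity_splitAt {n : ℕ} {d : Fin n → ℕ} (k : Fin n) (ψ : QuditSpace d) :
    reducedDensity (splitAt k ψ) = coeffMatrix k ψ.ofLp * (coeffMatrix k ψ.ofLp)ᴴ := by
  ext x x'
  simp [reducedDensity, partialTraceRight, pureDensity, splitAt, coeffMatrix, Matrix.mul_apply,
    Matrix.vecMulVec_apply]

open scoped ComplexOrder in
theorem posSemidef_reducedDensity_splitAt {n : ℕ} {d : Fin n → ℕ} (k : Fin n)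
    (ψ : QuditSpace d) : (reducedDensity (splitAt k ψ)).PosSemidef := by
  rw [reducedDensity_splitAt]
  exact Matrix.posSemidef_self_mul_conjTranspose _

open scoped ComplexOrder in
/-- The spectra of the one-party marginals of a pure state: probability distributions which
compute `tr ρ ^ q` and satisfy the one-to-group inequality for `ℓ^q` norms. -/
theorem exists_marginal_spectra {n : ℕ} {d : Fin n → ℕ} {ψ : QuditSpace d} (hψ : ‖ψ‖ = 1) :
    ∃ l : ∀ i, Fin (d i) → ℝ, (∀ i x, 0 ≤ l i x) ∧ (∀ i, ∑ x, l i x = 1) ∧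
      (∀ i q, tracePow (reducedDensity (splitAt i ψ)) q = ∑ x, l i x ^ q) ∧
      ∀ q, 1 < q → ∀ j,
        1 - lpNorm q (l j) ≤ ∑ k ∈ Finset.univ.erase j, (1 - lpNorm q (l k)) := by
  have hH : ∀ k, (reducedDensity (splitAt k ψ)).IsHermitian := fun k =>
    (posSemidef_reducedDensity_splitAt k ψ).isHermitian
  set U : ∀ k, Matrix (Fin (d k)) (Fin (d k)) ℂ := fun k => (hH k).eigenvectorUnitary with hU
  have hUU : ∀ k, ((U k)ᴴ)ᴴ * (U k)ᴴ = 1 := fun k => by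
    rw [Matrix.conjTranspose_conjTranspose]
    exact Unitary.coe_mul_star_self (hH k).eigenvectorUnitary
  set φ := productMatrix (fun k => (U k)ᴴ) *ᵥ ψ.ofLp with hφ
  have hA : ∀ k, coeffMatrix k φ * (coeffMatrix k φ)ᴴ =
      Matrix.diagonal fun x => ((hH k).eigenvalues x : ℂ) := fun k => by
    have h := (hH k).conjStarAlgAut_star_eigenvectorUnitary
    rw [Unitary.conjStarAlgAut_star_apply] at h
    rw [hφ, coeffMatrix_mulVec_mul_conjTranspose hUU, ← reducedDensity_splitAt,
      Matrix.conjTranspose_conjTranspose]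
    exact h
  have hsum : ∀ k, ∑ x, (hH k).eigenvalues x = 1 := fun k => by
    have h : ((∑ s, ‖ψ s‖ ^ 2 : ℝ) : ℂ) = ∑ x, ((hH k).eigenvalues x : ℂ) := by
      rw [← trace_coeffMatrix_mul_conjTranspose k, ← reducedDensity_splitAt]
      exact (hH k).trace_eq_sum_eigenvalues
    rw [← EuclideanSpace.norm_sq_eq, hψ, ← Complex.ofReal_sum] at h
    simpa using (Complex.ofReal_injective h).symm
  refine ⟨fun k => (hH k).eigenvalues,
    fun k => (posSemidef_reducedDensity_splitAt k ψ).eigenvalues_nonneg, hsum,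
    fun k q => tracePow_eq_sum_eigenvalues (hH k) q, fun q hq j => ?_⟩
  refine one_sub_lpNorm_le_sum ?_
    (fun k => (posSemidef_reducedDensity_splitAt k ψ).eigenvalues_nonneg) hA hq j
  have h := trace_coeffMatrix_mul_conjTranspose j φ
  rw [hA, Matrix.trace_diagonal, ← Complex.ofReal_sum, hsum] at h
  exact_mod_cast h.symm

theorem lpNorm_nonneg {a : Type*} [Fintype a] (q : ℝ) {f : a → ℝ} (hf : ∀ x, 0 ≤ f x) :
    0 ≤ lpNorm q f :=
  Real.rpow_nonneg (Finset.sum_nonneg fun x _ => Real.rpow_nonneg (hf x) q) _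

theorem lpNorm_le_one {a : Type*} [Fintype a] {q : ℝ} (hq : 1 ≤ q) {f : a → ℝ}
    (hf : ∀ x, 0 ≤ f x) (hsum : ∑ x, f x = 1) : lpNorm q f ≤ 1 := by
  refine Real.rpow_le_one (Finset.sum_nonneg fun x _ => Real.rpow_nonneg (hf x) q) ?_
    (by positivity)
  rw [← hsum]
  refine Finset.sum_le_sum fun x hx => ?_
  have h1 : f x ≤ 1 := hsum ▸ Finset.single_le_sum (fun y _ => hf y) hx
  rcases (hf x).eq_or_lt with h | h
  · rw [← h, Real.zero_rpow (by linarith)]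
  · simpa using Real.rpow_le_rpow_of_exponent_ge h h1 hq

end UnifiedConcurrence

theorem mainTheorem7 {n : ℕ} (d : Fin n → ℕ) (hd : ∀ i, 2 ≤ d i)
    (ψ : UnifiedConcurrence.QuditSpace d) (hψ : ‖ψ‖ = 1)
    (q s : ℝ) (hq : 1 ≤ q) (hqs : 1 ≤ q * s) (j : Fin n) :
    UnifiedConcurrence.marginalConcurrence q s j ψ ≤
      ∑ k ∈ Finset.univ.erase j, UnifiedConcurrence.marginalConcurrence q s k ψ := by
  obtain ⟨l, hl0, hl1, htr, hineq⟩ := UnifiedConcurrence.exists_marginal_spectra hψ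
  have hq0 : q ≠ 0 := by linarith
  have hC : ∀ k, UnifiedConcurrence.marginalConcurrence q s k ψ =
      1 - UnifiedConcurrence.lpNorm q (l k) ^ (q * s) := fun k => by
    have h0 : 0 ≤ ∑ x, l k x ^ q := Finset.sum_nonneg fun x _ => Real.rpow_nonneg (hl0 k x) q
    rw [UnifiedConcurrence.marginalConcurrence, UnifiedConcurrence.concurrence,
      UnifiedConcurrence.signFactor, if_pos ⟨hq, hqs⟩, one_mul, htr,
      UnifiedConcurrence.lpNorm, ← Real.rpow_mul h0, one_div, inv_mul_cancel_left₀ hq0]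
  simp only [hC]
  rcases hq.eq_or_lt with rfl | hq1
  · simp [UnifiedConcurrence.lpNorm, hl1]
  · exact UnifiedConcurrence.one_sub_rpow_le_sum _ hqs
      (fun k _ => UnifiedConcurrence.lpNorm_nonneg q (hl0 k))
      (fun k _ => UnifiedConcurrence.lpNorm_le_one hq (hl0 k) (hl1 k))
      (UnifiedConcurrence.lpNorm_nonneg q (hl0 j))
      (UnifiedConcurrence.lpNorm_le_one hq (hl0 j) (hl1 j)) (hineq q hq1 j)
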